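/- Let $n\ge 1$ and $N=\binom{2n+2}{n+1}-1$. An $n$-plane is an $n$-dimensional projective linear subspace $\ell$ of $\mathbb P^{2n+1}=\mathbb P(\mathbb C^{2n+2})$; let $\hat\ell\in\mathbb P^N$ be its point of Plücker coordinates. Let $\rho:\mathrm{PGL}_{2n+2}(\mathbb C)\to \mathrm{PGL}_{N+1}(\mathbb C)$ be the homomorphism that sends the class of $A$ to the class of the matrix $\hat A$ of its $(n+1)\times(n+1)$ minors, and put $\hat\sigma=\rho(\sigma)$. A sequence of distinct elements $\sigma_\nu$ of $\mathrm{PGL}_{k}(\mathbb C)$ is called convergent in norm if there are representatives $\tilde\sigma_\nu\in \mathrm{GL}_{k}(\mathbb C)$ of $\sigma_\nu$ whose largest entry in absolute value is $1$ and which converge to a matrix $\tilde\sigma$; its limit image is the projective linear subspace defined by the image of $\tilde\sigma$. For a discrete subgroup $\Gamma\subset \mathrm{PGL}_{2n+2}(\mathbb C)$, a sequence $\{\sigma_\nu\}\subset\Gamma$ is normal if both $\{\sigma_\nu\}$ and $\{\hat\sigma_\nu\}$ are convergent in norm. An $n$-plane $\ell$ is a limit $n$-plane of $\Gamma$ if $\hat\ell$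 lies in the limit image of $\{\hat\sigma_\nu\}$ for some normal sequence $\{\sigma_\nu\}\subset\Gamma$. Let $\Omega(\Gamma)$ be the complement in $\mathbb P^{2n+1}$ of the union of all limit $n$-planes of $\Gamma$. The discrete subgroup $\Gamma$ is of type L if $\Omega(\Gamma)$ contains a domain (a connected open subset of $\mathbb P^{2n+1}$) that contains an $n$-plane. **Theorem.** Let $\Gamma\subset \mathrm{PGL}_{2n+2}(\mathbb C)$ be a group of type L, and let $\{\sigma_\nu\}$ be a sequence of distinct elements of $\Gamma$. Then there are limit $n$-planes $\ell_I,\ell_K$ of $\Gamma$ and a subsequence $\{\tau_\nu\}$ of $\{\sigma_\nu\}$ such that for every compact subset $M\subset\mathbb P^{2n+1}\setminus\ell_K$ and every neighborhood $V$ of $\ell_I$ there is an integer $m_0$ with $\tau_\nu(M)\subset V$ for all $\nu>m_0$. -/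

import Mathlib

open Filter Topology
open scoped LinearAlgebra.Projectivization

noncomputable section

namespace TypeL

/-! ### Topologies on projective space and on the projective linear group -/

/-- The usual (quotient) topology of the projective space `ℙ(ℂ^ι)`. -/
instance projTopology (ι : Type*) : TopologicalSpace (ℙ ℂ (ι → ℂ)) :=
  TopologicalSpace.coinduced
    (fun v : {v : ι → ℂ // v ≠ 0} => Projectivization.mk ℂ v.1 v.2) inferInstance

/-- `PGL_ι(ℂ)`. -/
abbrev PGL (ι : Type*) [Fintype ι] [DecidableEq ι] : Type _ := Matrix.ProjGenLinGroup ι ℂ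

/-- The usual (quotient) topology of `PGL_ι(ℂ) = GL_ι(ℂ) / center`. -/
instance pglTopology (ι : Type*) [Fintype ι] [DecidableEq ι] : TopologicalSpace (PGL ι) :=
  TopologicalSpace.coinduced
    (fun g : Matrix.GeneralLinearGroup ι ℂ => (Matrix.ProjGenLinGroup.mk g : PGL ι)) inferInstance

/-- The projective linear subspace (as a set of points) defined by a linear subspace. -/
def projPoints {ι : Type*} (W : Submodule ℂ (ι → ℂ)) : Set (ℙ ℂ (ι → ℂ)) :=
  {p | p.submodule ≤ W}

/-! ### Normal sequences -/

/-- `|A| = max_{j,k} |a_{jk}|` (the sup norm of the array of entries). -/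
def maxEntry {ι : Type*} [Fintype ι] (A : Matrix ι ι ℂ) : ℝ :=
  ‖(fun j k => A j k : ι → ι → ℂ)‖

/-- `S` is the limit of a sequence of representatives `g ν` of `σ ν` with `|g ν| = 1`. -/
def IsNormalizedLimit {ι : Type*} [Fintype ι] [DecidableEq ι]
    (σ : ℕ → PGL ι) (S : Matrix ι ι ℂ) : Prop :=
  ∃ g : ℕ → Matrix.GeneralLinearGroup ι ℂ,
    (∀ ν, Matrix.ProjGenLinGroup.mk (g ν) = σ ν) ∧
    (∀ ν, maxEntry (g ν : Matrix ι ι ℂ) = 1) ∧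
    Tendsto (fun ν => (g ν : Matrix ι ι ℂ)) atTop (𝓝 S)

/-- A sequence of distinct elements of `PGL_ι(ℂ)` for which representatives of norm `1`
can be chosen to form a convergent sequence of matrices. -/
def IsNormalSeq {ι : Type*} [Fintype ι] [DecidableEq ι] (σ : ℕ → PGL ι) : Prop :=
  Function.Injective σ ∧ ∃ S : Matrix ι ι ℂ, IsNormalizedLimit σ S

/-! ### `n`-planes in `ℙ^{2n+1}` and Plücker coordinates -/

/-- Coordinate indices of `ℂ^{2n+2}`. -/
abbrev Idx (n : ℕ) : Type := Fin (2 * n + 2)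

/-- Multi-indices: the subsets of cardinality `n+1` of the set of coordinate indices. -/
abbrev MIdx (n : ℕ) : Type := Set.powersetCard (Idx n) (n + 1)

/-- The elements `k_0 < ⋯ < k_n` of a multi-index in increasing order. -/
def MIdx.elt {n : ℕ} (K : MIdx n) : Fin (n + 1) ↪o Idx n :=
  Set.powersetCard.ofFinEmbEquiv.symm K

/-- The projective space `ℙ^{2n+1}`. -/
abbrev PSpace (n : ℕ) : Type := ℙ ℂ (Idx n → ℂ)

/-- An `n`-plane in `ℙ^{2n+1}`, given by the corresponding `(n+1)`-dimensional linear subspace of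
`ℂ^{2n+2}`. -/
structure NPlane (n : ℕ) where
  toSubmodule : Submodule ℂ (Idx n → ℂ)
  finrank_eq : Module.finrank ℂ toSubmodule = n + 1

/-- The support `|ℓ|` of an `n`-plane: its set of points. -/
def NPlane.support {n : ℕ} (l : NPlane n) : Set (PSpace n) := projPoints l.toSubmodule

/-- The vector of maximal minors `X^K` of the matrix with columns `x_0, …, x_n`, that is, the
coordinate vector of `x_0 ∧ ⋯ ∧ x_n`. -/
def pluckerVec {n : ℕ} (x : Fin (n + 1) → Idx n → ℂ) : MIdx n → ℂ :=
  fun K => (Matrix.of fun i j => x j (K.elt i)).det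

theorem pluckerVec_ne_zero {n : ℕ} {x : Fin (n + 1) → Idx n → ℂ}
    (hx : LinearIndependent ℂ x) : pluckerVec x ≠ 0 := by
  intro h
  have h1 := exteriorPower.ιMulti_family_linearIndependent_field (n := n + 1) hx
  let s : Set.powersetCard (Fin (n + 1)) (n + 1) :=
    Set.powersetCard.ofFinEmbEquiv (RelEmbedding.refl _)
  apply h1.ne_zero s
  have h2 : exteriorPower.ιMulti_family ℂ (n + 1) x s = exteriorPower.ιMulti ℂ (n + 1) x := by
    simp only [exteriorPower.ιMulti_family, s, Equiv.symm_apply_apply]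
    rfl
  rw [h2]
  apply ((Pi.basisFun ℂ (Idx n)).exteriorPower (n + 1)).repr.injective
  ext K
  rw [exteriorPower.basis_repr_apply, exteriorPower.ιMultiDual_apply_ιMulti]
  rw [map_zero, Finsupp.zero_apply, ← Matrix.det_transpose]
  exact congrFun h K

/-- The point `ℓ̂` of `ℙ^N` with the Plücker coordinates of `ℓ`, computed with some basis of the
linear subspace of `ℓ` (it does not depend on the basis, see `NPlane.plucker_eq`). -/
def NPlane.plucker {n : ℕ} (l : NPlane n) : ℙ ℂ (MIdx n → ℂ) :=
  Projectivization.mk ℂ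
    (pluckerVec fun j => (Module.finBasisOfFinrankEq ℂ l.toSubmodule l.finrank_eq j : Idx n → ℂ))
    (pluckerVec_ne_zero
      ((Module.finBasisOfFinrankEq ℂ l.toSubmodule l.finrank_eq).linearIndependent.map'
        l.toSubmodule.subtype (Submodule.ker_subtype _)))

theorem NPlane.plucker_eq {n : ℕ} (l : NPlane n) {x : Fin (n + 1) → Idx n → ℂ}
    (hx : LinearIndependent ℂ x) (hmem : ∀ j, x j ∈ l.toSubmodule) :
    l.plucker = Projectivization.mk ℂ (pluckerVec x) (pluckerVec_ne_zero hx) := by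
  symm
  rw [NPlane.plucker, Projectivization.mk_eq_mk_iff']
  set b := Module.finBasisOfFinrankEq ℂ l.toSubmodule l.finrank_eq with hb
  refine ⟨(Matrix.of fun i j => b.repr ⟨x j, hmem j⟩ i).det, ?_⟩
  ext K
  rw [Pi.smul_apply, smul_eq_mul, mul_comm, pluckerVec, pluckerVec, ← Matrix.det_mul]
  congr 1
  ext i j
  have h := congrArg (fun v : l.toSubmodule => (v : Idx n → ℂ) (K.elt i))
    (b.sum_repr ⟨x j, hmem j⟩)
  simp only [Submodule.coe_sum, Finset.sum_apply, Submodule.coe_smul, Pi.smul_apply,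
    smul_eq_mul] at h
  simp only [Matrix.mul_apply, Matrix.of_apply]
  rw [← h]
  exact Finset.sum_congr rfl fun _ _ => mul_comm _ _

/-! ### The representation `ρ : PGL_{2n+2}(ℂ) → PGL_{N+1}(ℂ)` -/

/-- The matrix `Â = (A^K_J)` of `(n+1) × (n+1)` minors of `A`; row index `K`, column index `J`. -/
def hatMatrix {n : ℕ} (A : Matrix (Idx n) (Idx n) ℂ) : Matrix (MIdx n) (MIdx n) ℂ :=
  Matrix.of fun K J => (A.submatrix K.elt J.elt).det

theorem hatMatrix_eq_toMatrix {n : ℕ} (A : Matrix (Idx n) (Idx n) ℂ) :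
    hatMatrix A = LinearMap.toMatrix ((Pi.basisFun ℂ (Idx n)).exteriorPower (n + 1))
      ((Pi.basisFun ℂ (Idx n)).exteriorPower (n + 1))
      (exteriorPower.map (n + 1) (Matrix.toLin' A)) := by
  ext K J
  rw [LinearMap.toMatrix_apply, exteriorPower.basis_apply, exteriorPower.map_apply_ιMulti_family,
    exteriorPower.basis_repr_apply, exteriorPower.ιMulti_family,
    exteriorPower.ιMultiDual_apply_ιMulti, ← Matrix.det_transpose]
  simp only [hatMatrix, Matrix.of_apply]
  congr 1
  ext i j
  simp [MIdx.elt, Matrix.col]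

/-- `A ↦ Â` is multiplicative. -/
def hatHom (n : ℕ) : Matrix (Idx n) (Idx n) ℂ →* Matrix (MIdx n) (MIdx n) ℂ where
  toFun := hatMatrix
  map_one' := by
    rw [hatMatrix_eq_toMatrix, Matrix.toLin'_one, exteriorPower.map_id, LinearMap.toMatrix_id]
  map_mul' A B := by
    rw [hatMatrix_eq_toMatrix, hatMatrix_eq_toMatrix, hatMatrix_eq_toMatrix, Matrix.toLin'_mul,
      exteriorPower.map_comp, LinearMap.toMatrix_comp _
        ((Pi.basisFun ℂ (Idx n)).exteriorPower (n + 1))]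

/-- `A ↦ Â` on invertible matrices. -/
def hatGL (n : ℕ) :
    Matrix.GeneralLinearGroup (Idx n) ℂ →* Matrix.GeneralLinearGroup (MIdx n) ℂ :=
  Units.map (hatHom n)

theorem hatGL_mem_center {n : ℕ} :
    Subgroup.center (Matrix.GeneralLinearGroup (Idx n) ℂ) ≤
      (Subgroup.center (Matrix.GeneralLinearGroup (MIdx n) ℂ)).comap (hatGL n) := by
  intro g hg
  rw [Matrix.GeneralLinearGroup.center_eq_range_scalar] at hg
  obtain ⟨u, rfl⟩ := hg
  rw [Subgroup.mem_comap, Matrix.GeneralLinearGroup.center_eq_range_scalar]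
  refine ⟨u ^ (n + 1), ?_⟩
  apply Units.ext
  have h1 := (hatHom n).map_one
  change _ = hatMatrix _
  change hatMatrix 1 = 1 at h1
  have h2 : (Matrix.GeneralLinearGroup.scalar (Idx n) u : Matrix (Idx n) (Idx n) ℂ)
      = (u : ℂ) • 1 := by
    ext i j
    simp [Matrix.one_apply, Matrix.diagonal_apply]
  rw [h2]
  have h3 : hatMatrix ((u : ℂ) • (1 : Matrix (Idx n) (Idx n) ℂ))
      = (u : ℂ) ^ (n + 1) • hatMatrix (1 : Matrix (Idx n) (Idx n) ℂ) := by
    ext K J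
    simp only [hatMatrix, Matrix.of_apply, Matrix.smul_apply, Matrix.submatrix_smul, Pi.smul_apply]
    rw [Matrix.det_smul, Fintype.card_fin, smul_eq_mul]
  rw [h3, h1]
  ext i j
  simp [Matrix.one_apply, Matrix.diagonal_pow, Matrix.diagonal_apply]

/-- The group homomorphism `ρ : PGL_{2n+2}(ℂ) → PGL_{N+1}(ℂ)`, `ρ([A]) = [Â]`. -/
def rho (n : ℕ) : PGL (Idx n) →* PGL (MIdx n) :=
  QuotientGroup.map _ _ (hatGL n) hatGL_mem_center

theorem rho_mk {n : ℕ} (g : Matrix.GeneralLinearGroup (Idx n) ℂ) :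
    rho n (Matrix.ProjGenLinGroup.mk g) = Matrix.ProjGenLinGroup.mk (hatGL n g) := rfl

/-! ### Limit `n`-planes, the set of discontinuity, type L groups -/

/-- A normal sequence of `Γ`: both `σ` and the induced sequence `σ̂ = ρ ∘ σ` are normal. -/
def IsNormalSeqIn {n : ℕ} (Γ : Subgroup (PGL (Idx n))) (σ : ℕ → PGL (Idx n)) : Prop :=
  (∀ ν, σ ν ∈ Γ) ∧ IsNormalSeq σ ∧ IsNormalSeq (fun ν => rho n (σ ν))

/-- `ℓ` is a limit `n`-plane of `Γ`: its Plücker point lies in the limit image (the projective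
subspace defined by the image of the limit matrix `S`) of `σ̂` for some normal sequence `σ`. -/
def IsLimitPlane {n : ℕ} (Γ : Subgroup (PGL (Idx n))) (l : NPlane n) : Prop :=
  ∃ (σ : ℕ → PGL (Idx n)) (S : Matrix (MIdx n) (MIdx n) ℂ),
    IsNormalSeqIn Γ σ ∧ IsNormalizedLimit (fun ν => rho n (σ ν)) S ∧
      l.plucker ∈ projPoints (LinearMap.range (Matrix.toLin' S))

/-- The limit set `Λ(Γ)`, the union of the supports of all limit `n`-planes. -/
def limitSet {n : ℕ} (Γ : Subgroup (PGL (Idx n))) : Set (PSpace n) :=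
  {p | ∃ l : NPlane n, IsLimitPlane Γ l ∧ p ∈ l.support}

/-- The set of discontinuity `Ω(Γ) = ℙ^{2n+1} \ Λ(Γ)`. -/
def discontinuitySet {n : ℕ} (Γ : Subgroup (PGL (Idx n))) : Set (PSpace n) := (limitSet Γ)ᶜ

/-- A large domain: a connected open subset of `ℙ^{2n+1}` that contains an `n`-plane. -/
def IsLargeDomain {n : ℕ} (U : Set (PSpace n)) : Prop :=
  IsOpen U ∧ IsConnected U ∧ ∃ l : NPlane n, l.support ⊆ U

/-- `Γ` is of type L: it is discrete, and `Ω(Γ)` contains a large domain. -/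
def IsTypeL {n : ℕ} (Γ : Subgroup (PGL (Idx n))) : Prop :=
  DiscreteTopology Γ ∧ ∃ U : Set (PSpace n), IsLargeDomain U ∧ U ⊆ discontinuitySet Γ

end TypeL

end

noncomputable section

namespace TypeL

open Matrix
open scoped ComplexOrder

/-! ### Singular value decomposition -/

/-! The proof reads the dynamics off singular values. Represent each element by `U * diagonal d * V`
with `U`, `V` unitary and `d` positive and decreasing, and pass to a subsequence along which `U →
U'` and `V → V'`.

The matrix of minors factors the same way, with the products of `n + 1` singular values in the
middle; the largest is `d_0 ⋯ d_n`. After division by it, the limit has the Plücker vector of the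
first `n + 1` columns of `U'` in its image, so these columns span a limit plane `ℓ_I`. Inversion
reverses the order of the singular values, so the same argument for the inverse sequence makes
`ℓ_K`, the locus where the first `n + 1` coordinates of `V' v` vanish, a limit plane. The general
criterion is `isLimitPlane_of_svd`.

Type L enters through `tendsto_singularValue_ratio`: `d_{n+1} / d_n → 0`. Otherwise `d_{n+1} ≥ ε
d_n` along a subsequence, and every plane spanned by `U' e_0, …, U' e_{n-1}` and a further vector of
`U'⟨e_n, e_{n+1}⟩` is a limit plane. These sweep out an `(n+1)`-plane, which meets every `n`-plane,
contradicting the existence of an `n`-plane in `Ω(Γ)`.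

Given the gap, on a compact set off `ℓ_K` the first `n + 1` coordinates of `V' v` are bounded below
relative to `v`; the diagonal factor makes them dominate, and images accumulate only on `ℓ_I`
(`eventually_smul_mem_of_svd`). -/

theorem submatrix_mem_unitaryGroup {m : ℕ} {W : Matrix (Fin m) (Fin m) ℂ}
    (hW : W ∈ unitaryGroup (Fin m) ℂ) (e f : Equiv.Perm (Fin m)) :
    W.submatrix e f ∈ unitaryGroup (Fin m) ℂ := by
  rw [mem_unitaryGroup_iff] at hW ⊢
  rw [star_eq_conjTranspose, conjTranspose_submatrix, submatrix_mul_equiv,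
    ← star_eq_conjTranspose, hW, submatrix_one_equiv]

/-- Diagonalise `Aᴴ * A` by a unitary `X` with the eigenvalues sorted decreasingly; their square
roots are the singular values, and `A * X` with normalised columns is the left factor. -/
theorem exists_svd {m : ℕ} (g : GeneralLinearGroup (Fin m) ℂ) :
    ∃ U ∈ unitaryGroup (Fin m) ℂ, ∃ V ∈ unitaryGroup (Fin m) ℂ, ∃ d : Fin m → ℝ,
      (∀ i, 0 < d i) ∧ Antitone d ∧
        (g : Matrix (Fin m) (Fin m) ℂ) = U * diagonal (fun i => (d i : ℂ)) * V := by
  obtain ⟨A, hA⟩ : ∃ A : Matrix (Fin m) (Fin m) ℂ, A = g.val := ⟨_, rfl⟩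
  rw [← hA]
  have hP : (Aᴴ * A).PosDef := PosDef.conjTranspose_mul_self A 
    (mulVec_injective_of_isUnit (hA ▸ g.isUnit))
  set e := hP.1.eigenvalues
  set W : Matrix (Fin m) (Fin m) ℂ := hP.1.eigenvectorUnitary.1
  have hW : W ∈ unitaryGroup (Fin m) ℂ := hP.1.eigenvectorUnitary.2
  let π : Equiv.Perm (Fin m) := Tuple.sort (fun i => -e i)
  have hπ : Antitone (e ∘ π) := by
    intro i j hij
    have := Tuple.monotone_sort (fun i => -e i) hij
    simpa [π] using this
  have hspec : Wᴴ * (Aᴴ * A) * W = diagonal (fun i => (e i : ℂ)) := by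
    have := hP.1.conjStarAlgAut_star_eigenvectorUnitary
    rw [Unitary.conjStarAlgAut_star_apply] at this
    exact this
  have hW2 : W.submatrix id π ∈ unitaryGroup (Fin m) ℂ :=
    submatrix_mem_unitaryGroup hW (Equiv.refl _) π
  set X := W.submatrix id π with hX
  have hspecX : Xᴴ * (Aᴴ * A) * X = diagonal (fun i => (e (π i) : ℂ)) := by
    have h1 : Xᴴ * (Aᴴ * A) * X = (Wᴴ * (Aᴴ * A) * W).submatrix π π := by
      ext i j
      simp [hX, Matrix.mul_apply]
    rw [h1, hspec, submatrix_diagonal_equiv]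
    rfl
  have hpos : ∀ i, 0 < e (π i) := fun i => hP.eigenvalues_pos _
  let D : Matrix (Fin m) (Fin m) ℂ := diagonal (fun i => ((√(e (π i)) : ℝ) : ℂ))
  let E : Matrix (Fin m) (Fin m) ℂ := diagonal (fun i => (((√(e (π i)))⁻¹ : ℝ) : ℂ))
  have hs : ∀ i, √(e (π i)) ≠ 0 := fun i => (Real.sqrt_pos.2 (hpos i)).ne'
  have hED : E * D = 1 := by
    simp only [E, D, diagonal_mul_diagonal, ← Complex.ofReal_mul]
    rw [← diagonal_one]
    congr 1
    ext i
    rw [inv_mul_cancel₀ (hs i)]; simp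
  have hEH : Eᴴ = E := by
    simp only [E, diagonal_conjTranspose]
    congr 1
    ext i
    simp
  have hEDE : E * diagonal (fun i => (e (π i) : ℂ)) * E = 1 := by
    simp only [E, diagonal_mul_diagonal, ← Complex.ofReal_mul]
    rw [← diagonal_one]
    congr 1
    ext i
    have : (√(e (π i)))⁻¹ * e (π i) * (√(e (π i)))⁻¹ = 1 := by
      nth_rw 2 [← Real.mul_self_sqrt (hpos i).le]
      field_simp [hs i]
    rw [this]; simp
  refine ⟨A * X * E, ?_, Xᴴ, ?_, fun i => √(e (π i)), fun i => Real.sqrt_pos.2 (hpos i), ?_, ?_⟩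
  · rw [mem_unitaryGroup_iff', star_eq_conjTranspose, conjTranspose_mul, conjTranspose_mul, hEH]
    calc E * (Xᴴ * Aᴴ) * (A * X * E) = E * (Xᴴ * (Aᴴ * A) * X) * E := by
          simp only [Matrix.mul_assoc]
      _ = 1 := by rw [hspecX, hEDE]
  · exact Unitary.star_mem hW2
  · intro i j hij
    exact Real.sqrt_le_sqrt (hπ hij)
  · change A = A * X * E * D * Xᴴ
    have hXX : X * Xᴴ = 1 := mem_unitaryGroup_iff.1 hW2
    rw [Matrix.mul_assoc (A * X), hED, Matrix.mul_one, Matrix.mul_assoc, hXX, Matrix.mul_one]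

/-! ### Injectivity of `ρ` -/

theorem ιMulti_ne_zero {k m : ℕ} {x : Fin k → Fin m → ℂ} (hx : LinearIndependent ℂ x) :
    ExteriorAlgebra.ιMulti ℂ k x ≠ 0 := by
  intro h
  have h1 := exteriorPower.ιMulti_family_linearIndependent_field (n := k) hx
  let s : Set.powersetCard (Fin k) k :=
    Set.powersetCard.ofFinEmbEquiv (RelEmbedding.refl _)
  apply h1.ne_zero s
  have h2 : exteriorPower.ιMulti_family ℂ k x s = exteriorPower.ιMulti ℂ k x := by
    simp only [exteriorPower.ιMulti_family, s, Equiv.symm_apply_apply]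
    rfl
  rw [h2]
  exact Subtype.ext h

theorem exists_linearIndependent_extension {m : ℕ} {u v : Fin m → ℂ}
    (h : LinearIndependent ℂ ![u, v]) (k : ℕ) (hk : k + 2 ≤ m) :
    ∃ w : Fin (k + 2) → Fin m → ℂ, LinearIndependent ℂ w ∧ w 0 = u ∧ w 1 = v := by
  induction k with
  | zero => exact ⟨![u, v], h, rfl, rfl⟩
  | succ k ih =>
    obtain ⟨w, hw, h0, h1⟩ := ih (by omega)
    obtain ⟨x, hx⟩ := exists_linearIndependent_snoc_of_lt_finrank (R := ℂ) hw (by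
      rw [Module.finrank_fin_fun]; omega)
    refine ⟨Fin.snoc w x, hx, ?_, ?_⟩
    · rw [← h0]; exact Fin.snoc_castSucc (α := fun _ => Fin m → ℂ) x w 0
    · rw [← h1]; exact Fin.snoc_castSucc (α := fun _ => Fin m → ℂ) x w 1

/-- If `A` is not scalar, some `v` is independent of `A v`. Extend to `n + 2` independent vectors `A
v, v, w_2, …`. The exterior power of `A` sends `v ∧ w_2 ∧ ⋯` to a product with factor `A v`, killed
by a further `A v`; but it is also `c` times the original, and `A v ∧ v ∧ w_2 ∧ ⋯ ≠ 0`. -/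
theorem exists_scalar_of_hatMatrix_eq_smul_one {n : ℕ} {A : Matrix (Idx n) (Idx n) ℂ} {c : ℂ}
    (hc : c ≠ 0) (h : hatMatrix A = c • 1) : ∃ a : ℂ, A = a • 1 := by
  have hmap : exteriorPower.map (n + 1) (toLin' A) = c • LinearMap.id := by
    apply (LinearMap.toMatrix ((Pi.basisFun ℂ (Idx n)).exteriorPower (n + 1))
      ((Pi.basisFun ℂ (Idx n)).exteriorPower (n + 1))).injective
    rw [← hatMatrix_eq_toMatrix, h, map_smul, LinearMap.toMatrix_id]
  obtain ⟨a, ha⟩ := LinearMap.exists_eq_smul_id_of_forall_notLinearIndependent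
    (f := toLin' A) (fun v hv => by
      obtain ⟨w, hw, h0, h1⟩ := exists_linearIndependent_extension
        (LinearIndependent.pair_symm_iff.1 hv) n (by omega)
      have hx : ExteriorAlgebra.ιMulti ℂ (n + 1) (toLin' A ∘ Matrix.vecTail w) =
          c • ExteriorAlgebra.ιMulti ℂ (n + 1) (Matrix.vecTail w) := by
        have := congrArg (fun f => (f (exteriorPower.ιMulti ℂ (n + 1) (Matrix.vecTail w)) :
          ExteriorAlgebra ℂ (Idx n → ℂ))) hmap
        simpa [exteriorPower.map_apply_ιMulti] using this
      have hz : ExteriorAlgebra.ι ℂ (w 0) *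
          ExteriorAlgebra.ιMulti ℂ (n + 1) (toLin' A ∘ Matrix.vecTail w) = 0 := by
        have := ExteriorAlgebra.ιMulti_succ_apply (R := ℂ)
          (Matrix.vecCons (w 0) (toLin' A ∘ Matrix.vecTail w))
        simp only [Matrix.cons_val_zero, Matrix.tail_cons] at this
        rw [← this]
        refine AlternatingMap.map_eq_zero_of_eq _ _ (i := 0) (j := 1) ?_ (by simp)
        change w 0 = toLin' A (w 1)
        rw [h0, h1]
      rw [hx, mul_smul_comm, ← ExteriorAlgebra.ιMulti_succ_apply, smul_eq_zero] at hz
      exact ιMulti_ne_zero hw (hz.resolve_left hc))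
  refine ⟨a, (toLin' (R := ℂ)).injective ?_⟩
  rw [ha, map_smul, toLin'_one]
  rfl

/-- Normality of a sequence demands that the induced elements `ρ(σ_ν)` be distinct as well;
injectivity supplies this. -/
theorem rho_injective (n : ℕ) : Function.Injective (rho n) := by
  rw [injective_iff_map_eq_one]
  intro σ hσ
  induction σ using Matrix.ProjGenLinGroup.induction_on with | mk g =>
  rw [rho_mk, ProjGenLinGroup.mk_eq_one, GeneralLinearGroup.center_eq_range_scalar] at hσ
  obtain ⟨u, hu⟩ := hσ
  have hh : hatMatrix (g : Matrix (Idx n) (Idx n) ℂ) = (u : ℂ) • 1 := by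
    have := congrArg (Units.val) hu
    change _ = hatMatrix _ at this
    rw [← this]
    ext i j
    simp [Matrix.one_apply, Matrix.diagonal_apply]
  obtain ⟨a, ha⟩ := exists_scalar_of_hatMatrix_eq_smul_one u.ne_zero hh
  have ha0 : a ≠ 0 := by
    rintro rfl
    rw [zero_smul] at ha
    exact g.ne_zero ha
  rw [ProjGenLinGroup.mk_eq_one, GeneralLinearGroup.center_eq_range_scalar]
  refine ⟨Units.mk0 a ha0, Units.ext ?_⟩
  rw [ha]
  ext i j
  simp [Matrix.one_apply, Matrix.diagonal_apply]

/-! ### Normalized limits -/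

theorem maxEntry_smul {ι : Type*} [Fintype ι] (a : ℂ) (A : Matrix ι ι ℂ) :
    maxEntry (a • A) = ‖a‖ * maxEntry A :=
  norm_smul a (fun j k => A j k : ι → ι → ℂ)

theorem continuous_maxEntry {ι : Type*} [Fintype ι] :
    Continuous (maxEntry : Matrix ι ι ℂ → ℝ) :=
  continuous_norm (E := ι → ι → ℂ)

theorem maxEntry_ne_zero {ι : Type*} [Fintype ι] {A : Matrix ι ι ℂ} (hA : A ≠ 0) :
    maxEntry A ≠ 0 :=
  norm_ne_zero_iff.2 (show (fun j k => A j k : ι → ι → ℂ) ≠ 0 from hA)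

/-- Any rescaling with a nonzero limit suffices: dividing by `maxEntry`, which converges to
`maxEntry S ≠ 0`, only multiplies the limit by a nonzero scalar. -/
theorem exists_isNormalizedLimit {ι : Type*} [Fintype ι] [DecidableEq ι]
    {σ : ℕ → PGL ι} {S : Matrix ι ι ℂ} (hS : S ≠ 0) (g : ℕ → GeneralLinearGroup ι ℂ)
    (hg : ∀ ν, ProjGenLinGroup.mk (g ν) = σ ν) (c : ℕ → ℂ) (hc : ∀ ν, c ν ≠ 0)
    (hlim : Tendsto (fun ν => c ν • (g ν : Matrix ι ι ℂ)) atTop (𝓝 S)) :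
    ∃ a : ℂ, a ≠ 0 ∧ IsNormalizedLimit σ (a • S) := by
  have : Nontrivial (Matrix ι ι ℂ) := ⟨S, 0, hS⟩
  have hne : ∀ ν, maxEntry (c ν • (g ν : Matrix ι ι ℂ)) ≠ 0 := fun ν =>
    maxEntry_ne_zero (smul_ne_zero (hc ν) (g ν).ne_zero)
  let a : ℕ → ℂ := fun ν => ((maxEntry (c ν • (g ν : Matrix ι ι ℂ)))⁻¹ : ℝ)
  have ha : ∀ ν, a ν ≠ 0 := fun ν => by
    simpa [a] using hne ν
  have hrep : ∀ ν, ((g ν * GeneralLinearGroup.scalar ι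
      (Units.mk0 (a ν * c ν) (mul_ne_zero (ha ν) (hc ν))) : GeneralLinearGroup ι ℂ) :
        Matrix ι ι ℂ) = a ν • c ν • (g ν : Matrix ι ι ℂ) := by
    intro ν
    ext i j
    simp [mul_comm, mul_assoc, mul_left_comm]
  refine ⟨((maxEntry S)⁻¹ : ℝ), by simpa using maxEntry_ne_zero hS,
    fun ν => g ν * GeneralLinearGroup.scalar ι
      (Units.mk0 (a ν * c ν) (mul_ne_zero (ha ν) (hc ν))), ?_, ?_, ?_⟩
  · intro ν
    rw [← hg ν, map_mul, ProjGenLinGroup.mk_scalar, mul_one]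
  · intro ν
    rw [hrep, maxEntry_smul]
    have h0 : 0 ≤ maxEntry (c ν • (g ν : Matrix ι ι ℂ)) := norm_nonneg (E := ι → ι → ℂ) _
    simp only [a, Complex.norm_real, norm_inv, Real.norm_of_nonneg h0]
    exact inv_mul_cancel₀ (hne ν)
  · simp only [hrep]
    refine Tendsto.smul ?_ hlim
    exact (Complex.continuous_ofReal.tendsto _).comp
      (((continuous_maxEntry.tendsto S).comp hlim).inv₀ (maxEntry_ne_zero hS))

/-! ### Compactness of the unitary group -/

instance matrix_firstCountable {ι : Type*} [Fintype ι] :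
    FirstCountableTopology (Matrix ι ι ℂ) :=
  inferInstanceAs (FirstCountableTopology (ι → ι → ℂ))

theorem isCompact_unitaryGroup (ι : Type*) [Fintype ι] [DecidableEq ι] :
    IsCompact (unitaryGroup ι ℂ : Set (Matrix ι ι ℂ)) := by
  have hK : IsCompact (Set.univ.pi fun _ => Set.univ.pi fun _ => Metric.closedBall 0 1 :
      Set (ι → ι → ℂ)) :=
    isCompact_univ_pi fun _ => isCompact_univ_pi fun _ => isCompact_closedBall _ _
  refine IsCompact.of_isClosed_subset hK ?_ ?_
  · have : (unitaryGroup ι ℂ : Set (Matrix ι ι ℂ)) = {A | A * Aᴴ = 1} := by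
      ext A
      exact mem_unitaryGroup_iff
    rw [this]
    exact isClosed_eq (continuous_id.matrix_mul continuous_id.matrix_conjTranspose)
      continuous_const
  · intro A hA i _ j _
    simpa using entry_norm_bound_of_unitary hA i j

/-! ### Plücker vectors and matrices of minors -/

theorem pluckerVec_eq_repr {n : ℕ} (x : Fin (n + 1) → Idx n → ℂ) :
    pluckerVec x = ((Pi.basisFun ℂ (Idx n)).exteriorPower (n + 1)).repr
      (exteriorPower.ιMulti ℂ (n + 1) x) := by
  ext K
  rw [exteriorPower.basis_repr_apply, exteriorPower.ιMultiDual_apply_ιMulti, ← det_transpose]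
  rfl

theorem pluckerVec_mulVec {n : ℕ} (A : Matrix (Idx n) (Idx n) ℂ)
    (x : Fin (n + 1) → Idx n → ℂ) :
    pluckerVec (fun j => A *ᵥ x j) = hatMatrix A *ᵥ pluckerVec x := by
  rw [hatMatrix_eq_toMatrix, pluckerVec_eq_repr x, LinearMap.toMatrix_mulVec_repr,
    exteriorPower.map_apply_ιMulti, pluckerVec_eq_repr]
  rfl

theorem hatMatrix_diagonal {n : ℕ} (d : Idx n → ℂ) :
    hatMatrix (diagonal d) = diagonal fun K : MIdx n => ∏ i, d (K.elt i) := by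
  ext K J
  rw [hatMatrix_eq_toMatrix, LinearMap.toMatrix_apply, exteriorPower.basis_apply,
    exteriorPower.map_apply_ιMulti_family]
  have h : exteriorPower.ιMulti_family ℂ (n + 1)
      (toLin' (diagonal d) ∘ Pi.basisFun ℂ (Idx n)) J =
      (∏ i, d (J.elt i)) •
        exteriorPower.ιMulti_family ℂ (n + 1) (Pi.basisFun ℂ (Idx n)) J := by
    simp only [exteriorPower.ιMulti_family]
    rw [← AlternatingMap.map_smul_univ]
    congr 1
    ext i k
    simp [MIdx.elt, Pi.single_apply, mulVec_diagonal]
    split_ifs with h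
    · rw [h]
    · rfl
  rw [h, ← exteriorPower.basis_apply, map_smul, Module.Basis.repr_self, Finsupp.smul_apply,
    diagonal_apply, Finsupp.single_apply]
  rcases eq_or_ne K J with rfl | hne
  · simp
  · simp [hne, hne.symm]

theorem hatMatrix_mul {n : ℕ} (A B : Matrix (Idx n) (Idx n) ℂ) :
    hatMatrix (A * B) = hatMatrix A * hatMatrix B := (hatHom n).map_mul A B

theorem hatMatrix_one {n : ℕ} : hatMatrix (1 : Matrix (Idx n) (Idx n) ℂ) = 1 :=
  (hatHom n).map_one

theorem continuous_hatMatrix {n : ℕ} :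
    Continuous (hatMatrix : Matrix (Idx n) (Idx n) ℂ → Matrix (MIdx n) (MIdx n) ℂ) :=
  continuous_matrix fun _ _ => (continuous_id.matrix_submatrix _ _).matrix_det

/-- The first `n + 1` coordinate indices. -/
def lowIdx {n : ℕ} (i : Fin (n + 1)) : Idx n := Fin.castLE (by omega) i

theorem lowIdx_le_elt {n : ℕ} (K : MIdx n) (i : Fin (n + 1)) : lowIdx i ≤ K.elt i := by
  rw [Fin.le_def]
  change (i : ℕ) ≤ K.elt i
  obtain ⟨i, hi⟩ := i
  induction i with
  | zero => exact Nat.zero_le _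
  | succ i ih =>
    have h1 := ih (by omega)
    have h2 : K.elt ⟨i, by omega⟩ < K.elt ⟨i + 1, hi⟩ := K.elt.strictMono (by simp)
    have h3 := Fin.lt_def.1 h2
    simp only at h1 ⊢
    omega

/-- A nonzero minor has a nonzero term in its Leibniz expansion. The permutation of that term
matches the elements of `K` with the `b j` so that each is at most its partner, and `d` is
decreasing. -/
theorem prod_le_prod_elt_of_pluckerVec_ne_zero {n : ℕ} {d : Idx n → ℝ} (hd0 : ∀ i, 0 < d i)
    (hd : Antitone d) {b : Fin (n + 1) → Idx n} {y : Fin (n + 1) → Idx n → ℂ}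
    (hyb : ∀ j k, y j k ≠ 0 → k ≤ b j) {K : MIdx n} (hK : pluckerVec y K ≠ 0) :
    ∏ j, d (b j) ≤ ∏ i, d (K.elt i) := by
  rw [pluckerVec, det_apply] at hK
  obtain ⟨π, -, hπ⟩ := Finset.exists_ne_zero_of_sum_ne_zero hK
  have hπ2 : ∏ i, y i (K.elt (π i)) ≠ 0 := fun h => hπ (by
    simp only [of_apply]; rw [h, smul_zero])
  rw [← Equiv.prod_comp π fun i => d (K.elt i)]
  exact Finset.prod_le_prod (fun j _ => (hd0 _).le) fun j _ =>
    hd (hyb _ _ (Finset.prod_ne_zero_iff.1 hπ2 j (Finset.mem_univ j)))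

theorem conjTranspose_mul_self_of_mem {ι : Type*} [Fintype ι] [DecidableEq ι]
    {U : Matrix ι ι ℂ} (hU : U ∈ unitaryGroup ι ℂ) : Uᴴ * U = 1 := mem_unitaryGroup_iff'.1 hU

theorem self_mul_conjTranspose_of_mem {ι : Type*} [Fintype ι] [DecidableEq ι]
    {U : Matrix ι ι ℂ} (hU : U ∈ unitaryGroup ι ℂ) : U * Uᴴ = 1 := mem_unitaryGroup_iff.1 hU

theorem mulVec_ne_zero_of_mem {n : ℕ} {U : Matrix (Idx n) (Idx n) ℂ}
    (hU : U ∈ unitaryGroup (Idx n) ℂ) {v : Idx n → ℂ} (hv : v ≠ 0) : U *ᵥ v ≠ 0 := by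
  intro h
  have : Uᴴ *ᵥ (U *ᵥ v) = v := by
    rw [mulVec_mulVec, conjTranspose_mul_self_of_mem hU, one_mulVec]
  rw [h, mulVec_zero] at this
  exact hv this.symm

theorem linearIndependent_mulVec {n : ℕ} {U : Matrix (Idx n) (Idx n) ℂ}
    (hU : U ∈ unitaryGroup (Idx n) ℂ) {y : Fin (n + 1) → Idx n → ℂ}
    (hy : LinearIndependent ℂ y) : LinearIndependent ℂ fun j => U *ᵥ y j :=
  hy.map' (toLin' U) (LinearMap.ker_eq_bot.2 (Function.LeftInverse.injective (g := (Uᴴ *ᵥ ·))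
    fun v => by
      change Uᴴ *ᵥ (U *ᵥ v) = v
      rw [mulVec_mulVec, conjTranspose_mul_self_of_mem hU, one_mulVec]))

/-- A plane is a limit plane as soon as it is spanned, in the limit of left singular vectors, by
vectors lying in the members of the singular flag indexed by `b`, and the product of the singular
values indexed by `b` is comparable to the product of the `n + 1` largest ones. -/
theorem isLimitPlane_of_svd {n : ℕ} {Γ : Subgroup (PGL (Idx n))} {τ : ℕ → PGL (Idx n)}
    (hτΓ : ∀ ν, τ ν ∈ Γ) (hτ : Function.Injective τ)
    (g : ℕ → GeneralLinearGroup (Idx n) ℂ) (hg : ∀ ν, ProjGenLinGroup.mk (g ν) = τ ν)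
    (U V : ℕ → Matrix (Idx n) (Idx n) ℂ) (d : ℕ → Idx n → ℝ)
    (hV : ∀ ν, V ν ∈ unitaryGroup (Idx n) ℂ) (hd0 : ∀ ν i, 0 < d ν i)
    (hd : ∀ ν, Antitone (d ν))
    (hsvd : ∀ ν, (g ν : Matrix (Idx n) (Idx n) ℂ) =
      U ν * diagonal (fun i => (d ν i : ℂ)) * V ν)
    {U' : Matrix (Idx n) (Idx n) ℂ} (hU' : U' ∈ unitaryGroup (Idx n) ℂ)
    (hU : Tendsto U atTop (𝓝 U')) {ε : ℝ} (hε : 0 < ε) {b : Fin (n + 1) → Idx n}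
    (hb : ∀ ν, ε * ∏ j, d ν (lowIdx j) ≤ ∏ j, d ν (b j))
    {y : Fin (n + 1) → Idx n → ℂ} (hy : LinearIndependent ℂ y)
    (hyb : ∀ j k, y j k ≠ 0 → k ≤ b j) (l : NPlane n)
    (hl : ∀ j, U' *ᵥ y j ∈ l.toSubmodule) : IsLimitPlane Γ l := by
  have hP : ∀ ν, 0 < ∏ j, d ν (lowIdx j) := fun ν => Finset.prod_pos fun j _ => hd0 ν _
  -- The singular values scaled by the largest one, their `(n + 1)`-fold products scaled by the
  -- largest such product, and the right factors all stay in compact sets.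
  let X : ℕ → (Idx n → ℝ) × (MIdx n → ℝ) × Matrix (Idx n) (Idx n) ℂ := fun ν =>
    (fun i => d ν i / d ν 0, fun K => (∏ i, d ν (K.elt i)) / ∏ j, d ν (lowIdx j), V ν)
  have hcomp : IsCompact ((Set.univ.pi fun _ => Set.Icc 0 1 : Set (Idx n → ℝ)) ×ˢ
      (Set.univ.pi fun _ => Set.Icc 0 1 : Set (MIdx n → ℝ)) ×ˢ
        (unitaryGroup (Idx n) ℂ : Set (Matrix (Idx n) (Idx n) ℂ))) :=
    (isCompact_univ_pi fun _ => isCompact_Icc).prod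
      ((isCompact_univ_pi fun _ => isCompact_Icc).prod (isCompact_unitaryGroup _))
  obtain ⟨⟨D, E, V'⟩, ⟨-, -, hV'⟩, φ, hφ, hlim⟩ := hcomp.tendsto_subseq (x := X) (by
    intro ν
    refine ⟨fun i _ => ⟨(div_pos (hd0 ν _) (hd0 ν _)).le, ?_⟩, fun K _ => ⟨?_, ?_⟩, hV ν⟩
    · exact div_le_one_of_le₀ (hd ν (Fin.zero_le i)) (hd0 ν 0).le
    · exact (div_pos (Finset.prod_pos fun j _ => hd0 ν _) (hP ν)).le
    · exact div_le_one_of_le₀ (Finset.prod_le_prod (fun j _ => (hd0 ν _).le)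
        fun j _ => hd ν (lowIdx_le_elt K j)) (hP ν).le)
  have hD : Tendsto (fun ν => (X (φ ν)).1) atTop (𝓝 D) := (continuous_fst.tendsto _).comp hlim
  have hE : Tendsto (fun ν => (X (φ ν)).2.1) atTop (𝓝 E) :=
    ((continuous_fst.comp continuous_snd).tendsto _).comp hlim
  have hVlim : Tendsto (fun ν => V (φ ν)) atTop (𝓝 V') :=
    ((continuous_snd.comp continuous_snd).tendsto _).comp hlim
  have hUlim : Tendsto (fun ν => U (φ ν)) atTop (𝓝 U') := hU.comp hφ.tendsto_atTop
  have hdiag : ∀ {ι : Type} [Fintype ι] [DecidableEq ι] {F : ℕ → ι → ℝ} {F' : ι → ℝ},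
      Tendsto F atTop (𝓝 F') → Tendsto (fun ν => diagonal fun i => (F ν i : ℂ)) atTop
        (𝓝 (diagonal fun i => (F' i : ℂ))) := by
    intro ι _ _ F F' hF
    have hc : Continuous fun f : ι → ℝ => (diagonal fun i => (f i : ℂ) : Matrix ι ι ℂ) :=
      Continuous.matrix_diagonal (by fun_prop)
    exact (hc.tendsto F').comp hF
  have hU'inv := conjTranspose_mul_self_of_mem hU'
  have hV'inv := self_mul_conjTranspose_of_mem hV'
  -- the limit of the sequence itself
  set S₁ : Matrix (Idx n) (Idx n) ℂ := U' * diagonal (fun i => (D i : ℂ)) * V' with hS₁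
  have hS₁lim : Tendsto (fun ν => ((d (φ ν) 0 : ℂ))⁻¹ •
      (g (φ ν) : Matrix (Idx n) (Idx n) ℂ)) atTop (𝓝 S₁) := by
    have := (hUlim.mul (hdiag hD)).mul hVlim
    refine this.congr fun ν => ?_
    rw [hsvd, ← Matrix.smul_mul, ← Matrix.mul_smul, ← diagonal_smul]
    congr 3
    ext i
    simp [X, div_eq_inv_mul]
  have hD0 : D 0 = 1 := by
    refine tendsto_nhds_unique ((continuous_apply 0).tendsto D |>.comp hD) ?_
    refine tendsto_const_nhds.congr fun ν => ?_
    simp [X, div_self (hd0 (φ ν) 0).ne']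
  have hS₁0 : S₁ ≠ 0 := by
    intro h
    have h1 : U'ᴴ * S₁ * V'ᴴ = diagonal (fun i => (D i : ℂ)) := by
      rw [hS₁, Matrix.mul_assoc, Matrix.mul_assoc, hV'inv, Matrix.mul_one, ← Matrix.mul_assoc,
        hU'inv, Matrix.one_mul]
    rw [h, Matrix.mul_zero, Matrix.zero_mul] at h1
    have h2 := congrFun (congrFun h1 0) 0
    simp [hD0] at h2
  -- the limit of the induced sequence
  set S₂ : Matrix (MIdx n) (MIdx n) ℂ :=
    hatMatrix U' * diagonal (fun K => (E K : ℂ)) * hatMatrix V' with hS₂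
  have hS₂lim : Tendsto (fun ν => ((∏ j, d (φ ν) (lowIdx j) : ℝ) : ℂ)⁻¹ •
      (hatGL n (g (φ ν)) : Matrix (MIdx n) (MIdx n) ℂ)) atTop (𝓝 S₂) := by
    have := (((continuous_hatMatrix.tendsto _).comp hUlim).mul (hdiag hE)).mul
      ((continuous_hatMatrix.tendsto _).comp hVlim)
    refine this.congr fun ν => ?_
    change _ = _ • hatMatrix (g (φ ν) : Matrix (Idx n) (Idx n) ℂ)
    rw [hsvd, hatMatrix_mul, hatMatrix_mul, hatMatrix_diagonal, ← Matrix.smul_mul, ← Matrix.mul_smul,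
      ← diagonal_smul]
    simp only [Function.comp_apply]
    congr 3
    ext K
    simp [X, div_eq_inv_mul]
  -- The limiting diagonal matrix is invertible on the support of the Plücker vector of `y`: there
  -- its entries are at least `ε`. This yields the explicit preimage in `hmem`.
  have hEpos : ∀ K, pluckerVec y K ≠ 0 → E K ≠ 0 := by
    intro K hK
    have h1 : ε ≤ E K := by
      refine ge_of_tendsto' ((continuous_apply K).tendsto E |>.comp hE) fun ν => ?_
      change ε ≤ (∏ i, d (φ ν) (K.elt i)) / ∏ j, d (φ ν) (lowIdx j)
      rw [le_div_iff₀ (hP _)]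
      exact (hb _).trans (prod_le_prod_elt_of_pluckerVec_ne_zero (hd0 _) (hd _) hyb hK)
    exact (hε.trans_le h1).ne'
  have hUy := linearIndependent_mulVec hU' hy
  have hmem : S₂ *ᵥ (hatMatrix V'ᴴ *ᵥ fun K => (E K : ℂ)⁻¹ * pluckerVec y K) =
      pluckerVec fun j => U' *ᵥ y j := by
    rw [pluckerVec_mulVec, hS₂, ← mulVec_mulVec, mulVec_mulVec _ (hatMatrix V'), ← hatMatrix_mul,
      hV'inv, hatMatrix_one, one_mulVec, ← mulVec_mulVec]
    congr 1
    ext K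
    rw [mulVec_diagonal]
    by_cases hK : pluckerVec y K = 0
    · simp [hK]
    · rw [mul_inv_cancel_left₀ (by exact_mod_cast hEpos K hK)]
  have hS₂0 : S₂ ≠ 0 := by
    intro h
    rw [h, zero_mulVec] at hmem
    exact pluckerVec_ne_zero hUy hmem.symm
  obtain ⟨a₁, -, ha₁⟩ := exists_isNormalizedLimit hS₁0 (fun ν => g (φ ν))
    (σ := fun ν => τ (φ ν)) (fun ν => hg _) _
    (fun ν => inv_ne_zero (by exact_mod_cast (hd0 _ _).ne')) hS₁lim
  obtain ⟨a₂, ha₂0, ha₂⟩ := exists_isNormalizedLimit hS₂0 (fun ν => hatGL n (g (φ ν)))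
    (σ := fun ν => rho n (τ (φ ν))) (fun ν => by rw [← hg, rho_mk]) _
    (fun ν => inv_ne_zero (by exact_mod_cast (hP _).ne')) hS₂lim
  have hinj : Function.Injective fun ν => τ (φ ν) := hτ.comp hφ.injective
  refine ⟨fun ν => τ (φ ν), a₂ • S₂, ⟨fun ν => hτΓ _, ⟨hinj, _, ha₁⟩,
    (rho_injective n).comp hinj, _, ha₂⟩, ha₂, ?_⟩
  rw [NPlane.plucker_eq l hUy hl]
  change Projectivization.submodule _ ≤ _
  rw [Projectivization.submodule_mk, Submodule.span_singleton_le_iff_mem, LinearMap.mem_range]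
  refine ⟨a₂⁻¹ • (hatMatrix V'ᴴ *ᵥ fun K => (E K : ℂ)⁻¹ * pluckerVec y K), ?_⟩
  rw [toLin'_apply, mulVec_smul, smul_mulVec, smul_smul, inv_mul_cancel₀ ha₂0, one_smul, hmem]

/-! ### Planes spanned by singular vectors -/

/-- The `n`-plane spanned by `n + 1` linearly independent vectors. -/
def NPlane.ofLinearIndependent {n : ℕ} (y : Fin (n + 1) → Idx n → ℂ)
    (hy : LinearIndependent ℂ y) : NPlane n where
  toSubmodule := Submodule.span ℂ (Set.range y)
  finrank_eq := by rw [finrank_span_eq_card hy, Fintype.card_fin]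

theorem lowIdx_injective {n : ℕ} : Function.Injective (lowIdx : Fin (n + 1) → Idx n) :=
  Fin.castLE_injective (by omega)

theorem linearIndependent_lowIdx (n : ℕ) :
    LinearIndependent ℂ fun j : Fin (n + 1) => (Pi.single (lowIdx j) 1 : Idx n → ℂ) := by
  have := (Pi.basisFun ℂ (Idx n)).linearIndependent.comp lowIdx lowIdx_injective
  convert this using 2
  simp

/-- The `n`-plane spanned by the first `n + 1` columns of a unitary matrix. -/
def flagPlane {n : ℕ} (U : Matrix (Idx n) (Idx n) ℂ) (hU : U ∈ unitaryGroup (Idx n) ℂ) :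
    NPlane n :=
  NPlane.ofLinearIndependent _ (linearIndependent_mulVec hU (linearIndependent_lowIdx n))

theorem mulVec_mem_flagPlane {n : ℕ} {U : Matrix (Idx n) (Idx n) ℂ}
    (hU : U ∈ unitaryGroup (Idx n) ℂ) {z : Idx n → ℂ} (hz : ∀ k : Idx n, n < k → z k = 0) :
    U *ᵥ z ∈ (flagPlane U hU).toSubmodule := by
  have h : z = ∑ j : Fin (n + 1), z (lowIdx j) • (Pi.single (lowIdx j) 1 : Idx n → ℂ) := by
    ext k
    rw [Finset.sum_apply]
    rcases lt_or_ge n (k : ℕ) with hk | hk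
    · rw [hz k hk, Finset.sum_eq_zero]
      intro j _
      have : k ≠ lowIdx j := by
        rintro rfl
        have := j.2
        simp [lowIdx] at hk
        omega
      simp [this]
    · have hk2 : k = lowIdx ⟨k, by omega⟩ := rfl
      rw [Finset.sum_eq_single ⟨k, by omega⟩]
      · rw [← hk2]; simp
      · intro j _ hj
        have : k ≠ lowIdx j := by
          rw [hk2]
          exact fun h => hj (lowIdx_injective h).symm
        simp [this]
      · simp
  rw [h, ← toLin'_apply, map_sum]
  refine Submodule.sum_mem _ fun j _ => ?_
  rw [map_smul, toLin'_apply]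
  exact Submodule.smul_mem _ _ (Submodule.subset_span ⟨j, rfl⟩)

theorem isLimitPlane_flagPlane {n : ℕ} {Γ : Subgroup (PGL (Idx n))} {τ : ℕ → PGL (Idx n)}
    (hτΓ : ∀ ν, τ ν ∈ Γ) (hτ : Function.Injective τ)
    (g : ℕ → GeneralLinearGroup (Idx n) ℂ) (hg : ∀ ν, ProjGenLinGroup.mk (g ν) = τ ν)
    (U V : ℕ → Matrix (Idx n) (Idx n) ℂ) (d : ℕ → Idx n → ℝ)
    (hV : ∀ ν, V ν ∈ unitaryGroup (Idx n) ℂ) (hd0 : ∀ ν i, 0 < d ν i)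
    (hd : ∀ ν, Antitone (d ν))
    (hsvd : ∀ ν, (g ν : Matrix (Idx n) (Idx n) ℂ) =
      U ν * diagonal (fun i => (d ν i : ℂ)) * V ν)
    {U' : Matrix (Idx n) (Idx n) ℂ} (hU' : U' ∈ unitaryGroup (Idx n) ℂ)
    (hU : Tendsto U atTop (𝓝 U')) : IsLimitPlane Γ (flagPlane U' hU') := by
  refine isLimitPlane_of_svd hτΓ hτ g hg U V d hV hd0 hd hsvd hU' hU one_pos
    (b := lowIdx) (fun ν => by rw [one_mul]) (linearIndependent_lowIdx n) ?_ _ ?_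
  · intro j k hk
    by_contra h
    apply hk
    rw [Pi.single_apply, if_neg]
    rintro rfl
    exact h le_rfl
  · intro j
    exact Submodule.subset_span ⟨j, rfl⟩

/-! ### The singular value gap -/

/-- Only `n` coordinates have index above `n + 1`, so their vanishing imposes `n` linear conditions
on a space of dimension `n + 1`. -/
theorem exists_mem_plane_of_vanishing {n : ℕ} (U : Matrix (Idx n) (Idx n) ℂ)
    (hU : U ∈ unitaryGroup (Idx n) ℂ) (l : NPlane n) :
    ∃ v : Idx n → ℂ, v ≠ 0 ∧ (∀ k : Idx n, n + 1 < k → v k = 0) ∧ U *ᵥ v ∈ l.toSubmodule := by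
  let f : l.toSubmodule →ₗ[ℂ] (Fin n → ℂ) :=
    (LinearMap.funLeft ℂ ℂ fun i : Fin n => (⟨i + n + 2, by omega⟩ : Idx n)) ∘ₗ toLin' Uᴴ ∘ₗ
      l.toSubmodule.subtype
  have hker : LinearMap.ker f ≠ ⊥ := LinearMap.ker_ne_bot_of_finrank_lt (by
    rw [l.finrank_eq, Module.finrank_fin_fun]; omega)
  obtain ⟨w, hw, hw0⟩ := (Submodule.ne_bot_iff _).1 hker
  have hUw : U *ᵥ (Uᴴ *ᵥ (w : Idx n → ℂ)) = w := by
    rw [mulVec_mulVec, self_mul_conjTranspose_of_mem hU, one_mulVec]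
  refine ⟨Uᴴ *ᵥ (w : Idx n → ℂ), ?_, ?_, ?_⟩
  · intro h
    rw [h, mulVec_zero] at hUw
    exact hw0 (Subtype.ext hUw.symm)
  · intro k hk
    have h1 := congrFun (LinearMap.mem_ker.1 hw) ⟨k - (n + 2), by omega⟩
    have h2 : (⟨k - (n + 2) + n + 2, by omega⟩ : Idx n) = k := Fin.ext (by
      simp only; omega)
    simpa [f, LinearMap.funLeft_apply, h2] using h1
  · rw [hUw]; exact w.2

/-- The coordinate index `n`. -/
def midIdx (n : ℕ) : Idx n := ⟨n, by omega⟩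

/-- The coordinate index `n + 1`. -/
def succIdx (n : ℕ) : Idx n := ⟨n + 1, by omega⟩

theorem linearIndependent_snoc_of_ne_zero {n : ℕ} {w : Idx n → ℂ}
    (hw : w (midIdx n) ≠ 0 ∨ w (succIdx n) ≠ 0) :
    LinearIndependent ℂ (Fin.snoc (α := fun _ => Idx n → ℂ)
      (fun j : Fin n => (Pi.single (lowIdx j.castSucc) 1 : Idx n → ℂ)) w) := by
  rw [linearIndependent_finSnoc]
  refine ⟨(linearIndependent_lowIdx n).comp _ (Fin.castSucc_injective n), fun hmem => ?_⟩
  have hle : Submodule.span ℂ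
      (Set.range fun j : Fin n => (Pi.single (lowIdx j.castSucc) 1 : Idx n → ℂ)) ≤
      LinearMap.ker (LinearMap.proj (R := ℂ) (φ := fun _ : Idx n => ℂ) (midIdx n)) ⊓
        LinearMap.ker (LinearMap.proj (R := ℂ) (φ := fun _ : Idx n => ℂ) (succIdx n)) := by
    rw [Submodule.span_le]
    rintro _ ⟨j, rfl⟩
    have h1 : lowIdx j.castSucc ≠ midIdx n := fun h => by
      have := congrArg Fin.val h
      simp [lowIdx, midIdx] at this
      omega
    have h2 : lowIdx j.castSucc ≠ succIdx n := fun h => by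
      have := congrArg Fin.val h
      simp [lowIdx, succIdx] at this
      omega
    simp [h1.symm, h2.symm]
  obtain ⟨h1, h2⟩ := hle hmem
  exact hw.elim (fun h => h h1) (fun h => h h2)

/-- Complete `e_0, …, e_{n-1}` by `v` itself if its coordinate `n` or `n + 1` is nonzero. Otherwise
`v` already lies in the span of the first `n` basis vectors, and `e_n` serves as the last one. -/
theorem exists_flag_vectors {n : ℕ} {v : Idx n → ℂ}
    (hv : ∀ k : Idx n, n + 1 < k → v k = 0) :
    ∃ y : Fin (n + 1) → Idx n → ℂ, LinearIndependent ℂ y ∧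
      (∀ j k, y j k ≠ 0 → k ≤ Fin.snoc (α := fun _ => Idx n)
        (fun j : Fin n => lowIdx j.castSucc) (succIdx n) j) ∧
      v ∈ Submodule.span ℂ (Set.range y) := by
  have key : ∀ w : Idx n → ℂ, (∀ k : Idx n, n + 1 < k → w k = 0) → ∀ j k,
      (Fin.snoc (α := fun _ => Idx n → ℂ)
        (fun j : Fin n => (Pi.single (lowIdx j.castSucc) 1 : Idx n → ℂ)) w :
          Fin (n + 1) → Idx n → ℂ) j k ≠ 0 →
        k ≤ Fin.snoc (α := fun _ => Idx n) (fun j : Fin n => lowIdx j.castSucc) (succIdx n) j := by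
    intro w hw2 j k
    refine Fin.lastCases ?_ (fun j => ?_) j
    · rw [Fin.snoc_last, Fin.snoc_last]
      intro hk
      by_contra h
      exact hk (hw2 k (by simpa [succIdx, Fin.lt_def] using h))
    · rw [Fin.snoc_castSucc, Fin.snoc_castSucc]
      intro hk
      by_contra h
      apply hk
      rw [Pi.single_apply, if_neg]
      rintro rfl
      exact h le_rfl
  by_cases h : v (midIdx n) ≠ 0 ∨ v (succIdx n) ≠ 0
  · refine ⟨_, linearIndependent_snoc_of_ne_zero h, key v hv, ?_⟩
    exact Submodule.subset_span ⟨Fin.last n, Fin.snoc_last (α := fun _ => Idx n → ℂ) _ _⟩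
  · push Not at h
    have he : (Pi.single (midIdx n) 1 : Idx n → ℂ) (midIdx n) ≠ 0 ∨
        (Pi.single (midIdx n) 1 : Idx n → ℂ) (succIdx n) ≠ 0 := Or.inl (by simp)
    refine ⟨_, linearIndependent_snoc_of_ne_zero he, key _ ?_, ?_⟩
    · intro k hk
      rw [Pi.single_apply, if_neg]
      rintro rfl
      simp [midIdx] at hk
    · have hvk : ∀ k : Idx n, n < k → v k = 0 := by
        intro k hk
        rcases eq_or_lt_of_le (Nat.succ_le_of_lt hk) with hk | hk
        · rw [← h.2]
          congr 1
          exact Fin.ext hk.symm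
        · exact hv k hk
      have h1 := mulVec_mem_flagPlane (one_mem (unitaryGroup (Idx n) ℂ)) hvk
      rw [one_mulVec] at h1
      refine (Submodule.span_le.2 ?_ :
        (flagPlane (1 : Matrix (Idx n) (Idx n) ℂ) (one_mem _)).toSubmodule ≤ _) h1
      rintro _ ⟨j, rfl⟩
      simp only [one_mulVec]
      refine Submodule.subset_span ⟨j, ?_⟩
      refine Fin.lastCases ?_ (fun j => ?_) j
      · exact Fin.snoc_last (α := fun _ => Idx n → ℂ) _ _
      · exact Fin.snoc_castSucc (α := fun _ => Idx n → ℂ) _ _ _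

/-- If `Ω(Γ)` contains an `n`-plane, the `(n+2)`-nd singular value becomes negligible
compared to the `(n+1)`-st one: otherwise limit planes would sweep out an `(n+1)`-plane. -/
theorem tendsto_singularValue_ratio {n : ℕ} {Γ : Subgroup (PGL (Idx n))} {l₀ : NPlane n}
    (hl₀ : l₀.support ⊆ discontinuitySet Γ) {τ : ℕ → PGL (Idx n)}
    (hτΓ : ∀ ν, τ ν ∈ Γ) (hτ : Function.Injective τ)
    (g : ℕ → GeneralLinearGroup (Idx n) ℂ) (hg : ∀ ν, ProjGenLinGroup.mk (g ν) = τ ν)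
    (U V : ℕ → Matrix (Idx n) (Idx n) ℂ) (d : ℕ → Idx n → ℝ)
    (hV : ∀ ν, V ν ∈ unitaryGroup (Idx n) ℂ) (hd0 : ∀ ν i, 0 < d ν i)
    (hd : ∀ ν, Antitone (d ν))
    (hsvd : ∀ ν, (g ν : Matrix (Idx n) (Idx n) ℂ) =
      U ν * diagonal (fun i => (d ν i : ℂ)) * V ν)
    {U' : Matrix (Idx n) (Idx n) ℂ} (hU' : U' ∈ unitaryGroup (Idx n) ℂ)
    (hU : Tendsto U atTop (𝓝 U')) :
    Tendsto (fun ν => d ν (succIdx n) / d ν (midIdx n)) atTop (𝓝 0) := by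
  by_contra hcon
  rw [Metric.tendsto_nhds] at hcon
  push Not at hcon
  obtain ⟨ε, hε, hfreq⟩ := hcon
  obtain ⟨φ, hφ, hφε⟩ := extraction_of_frequently_atTop hfreq
  obtain ⟨v, hv0, hv, hvl⟩ := exists_mem_plane_of_vanishing U' hU' l₀
  obtain ⟨y, hy, hyb, hvy⟩ := exists_flag_vectors hv
  have hUy := linearIndependent_mulVec hU' hy
  have hlim : IsLimitPlane Γ (NPlane.ofLinearIndependent _ hUy) := by
    refine isLimitPlane_of_svd (τ := fun ν => τ (φ ν)) (fun ν => hτΓ _)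
      (hτ.comp hφ.injective) (fun ν => g (φ ν)) (fun ν => hg _) (fun ν => U (φ ν))
      (fun ν => V (φ ν)) (fun ν => d (φ ν)) (fun ν => hV _) (fun ν => hd0 _) (fun ν => hd _)
      (fun ν => hsvd _) hU' (hU.comp hφ.tendsto_atTop) hε ?_ hy hyb _
      (fun j => Submodule.subset_span ⟨j, rfl⟩)
    intro ν
    -- The two products differ only in the last factor, `d_n` against `d_{n+1}`, so the comparison
    -- reduces to `ε d_n ≤ d_{n+1}`.
    simp only [Fin.prod_univ_castSucc, Fin.snoc_castSucc, Fin.snoc_last]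
    have h1 : ε ≤ d (φ ν) (succIdx n) / d (φ ν) (midIdx n) := by
      have := hφε ν
      rwa [Real.dist_0_eq_abs, abs_of_pos (div_pos (hd0 _ _) (hd0 _ _))] at this
    rw [le_div_iff₀ (hd0 _ _)] at h1
    have h2 : (lowIdx (Fin.last n) : Idx n) = midIdx n := rfl
    rw [h2]
    have h3 : 0 < ∏ j : Fin n, d (φ ν) (lowIdx j.castSucc) :=
      Finset.prod_pos fun j _ => hd0 _ _
    calc _ = (∏ j : Fin n, d (φ ν) (lowIdx j.castSucc)) * (ε * d (φ ν) (midIdx n)) := by ring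
      _ ≤ _ := mul_le_mul_of_nonneg_left h1 h3.le
  have hUv0 : U' *ᵥ v ≠ 0 := mulVec_ne_zero_of_mem hU' hv0
  have hp₀ : Projectivization.mk ℂ (U' *ᵥ v) hUv0 ∈ l₀.support := by
    change Projectivization.submodule _ ≤ _
    rwa [Projectivization.submodule_mk, Submodule.span_singleton_le_iff_mem]
  -- The point `[U' v]` lies both on `l₀` and on a limit plane.
  refine hl₀ hp₀ ⟨_, hlim, ?_⟩
  change Projectivization.submodule _ ≤ _
  rw [Projectivization.submodule_mk, Submodule.span_singleton_le_iff_mem]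
  have h4 := Submodule.mem_map_of_mem (f := toLin' U') hvy
  rw [Submodule.map_span, ← Set.range_comp] at h4
  exact h4

/-! ### Dynamics -/

theorem isOpen_cone {n : ℕ} {W : Set (PSpace n)} (hW : IsOpen W) :
    IsOpen {v : Idx n → ℂ | ∃ h : v ≠ 0, Projectivization.mk ℂ v h ∈ W} := by
  have h1 : IsOpen ((fun v : {v : Idx n → ℂ // v ≠ 0} => Projectivization.mk ℂ v.1 v.2) ⁻¹' W) :=
    isOpen_coinduced.1 hW
  have h2 := (isOpen_ne (x := (0 : Idx n → ℂ))).isOpenMap_subtype_val _ h1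
  convert h2 using 1
  ext v
  constructor
  · rintro ⟨h, hv⟩
    exact ⟨⟨v, h⟩, hv, rfl⟩
  · rintro ⟨⟨v, h⟩, hv, rfl⟩
    exact ⟨h, hv⟩

theorem mem_support_mk {n : ℕ} {l : NPlane n} {v : Idx n → ℂ} (hv : v ≠ 0) :
    Projectivization.mk ℂ v hv ∈ l.support ↔ v ∈ l.toSubmodule := by
  change Projectivization.submodule _ ≤ _ ↔ _
  rw [Projectivization.submodule_mk, Submodule.span_singleton_le_iff_mem]

/-- A compact set of points at which the first `n + 1` coordinates of `V v` do not all vanish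
is uniformly away from the locus where they do. -/
theorem exists_norm_lt_of_isCompact {n : ℕ} (V : Matrix (Idx n) (Idx n) ℂ)
    {M : Set (PSpace n)} (hM : IsCompact M)
    (hV : ∀ v (hv : v ≠ 0), Projectivization.mk ℂ v hv ∈ M →
      (fun i : Fin (n + 1) => (V *ᵥ v) (lowIdx i)) ≠ 0) :
    ∃ j : ℕ, ∀ v (hv : v ≠ 0), Projectivization.mk ℂ v hv ∈ M →
      ‖v‖ < j * ‖fun i : Fin (n + 1) => (V *ᵥ v) (lowIdx i)‖ := by
  -- The defining inequality is invariant under scaling, so these sets form an increasing sequence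
  -- of open sets, which covers `M`.
  let W : ℕ → Set (PSpace n) := fun j => {p | ∃ v, ∃ hv : v ≠ 0, p = Projectivization.mk ℂ v hv ∧
    ‖v‖ < j * ‖fun i : Fin (n + 1) => (V *ᵥ v) (lowIdx i)‖}
  have hmem : ∀ j v (hv : v ≠ 0), Projectivization.mk ℂ v hv ∈ W j ↔
      ‖v‖ < j * ‖fun i : Fin (n + 1) => (V *ᵥ v) (lowIdx i)‖ := by
    intro j v hv
    refine ⟨?_, fun h => ⟨v, hv, rfl, h⟩⟩
    rintro ⟨w, hw, heq, h⟩
    obtain ⟨a, rfl⟩ := (Projectivization.mk_eq_mk_iff' ℂ v w hv hw).1 heq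
    have ha : a ≠ 0 := by
      rintro rfl
      exact hv (zero_smul _ _)
    have h1 : (fun i : Fin (n + 1) => (V *ᵥ (a • w)) (lowIdx i)) =
        a • fun i : Fin (n + 1) => (V *ᵥ w) (lowIdx i) := by
      ext i
      rw [mulVec_smul]
      rfl
    rw [h1, norm_smul, norm_smul, mul_left_comm]
    exact mul_lt_mul_of_pos_left h (norm_pos_iff.2 ha)
  have hopen : ∀ j, IsOpen (W j) := by
    intro j
    refine isOpen_coinduced.2 ?_
    have : (fun v : {v : Idx n → ℂ // v ≠ 0} => Projectivization.mk ℂ v.1 v.2) ⁻¹' W j =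
        {v | ‖v.1‖ < j * ‖fun i : Fin (n + 1) => (V *ᵥ v.1) (lowIdx i)‖} := by
      ext v
      exact hmem j v.1 v.2
    rw [this]
    refine isOpen_lt (by fun_prop) (continuous_const.mul (continuous_norm.comp ?_))
    have hc : Continuous fun v : {v : Idx n → ℂ // v ≠ 0} => V *ᵥ v.1 :=
      continuous_const.matrix_mulVec continuous_subtype_val
    exact continuous_pi fun i => continuous_pi_iff.1 hc (lowIdx i)
  obtain ⟨j, hj⟩ := hM.elim_directed_cover W hopen (by
    intro p hp
    induction p using Projectivization.ind with | h v hv =>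
    obtain ⟨j, hj⟩ := exists_nat_gt
      (‖v‖ / ‖fun i : Fin (n + 1) => (V *ᵥ v) (lowIdx i)‖)
    rw [div_lt_iff₀ (norm_pos_iff.2 (hV v hv hp))] at hj
    exact Set.mem_iUnion.2 ⟨j, (hmem j v hv).2 hj⟩) (by
    refine directed_of_isDirected_le fun i j hij => ?_
    rintro p ⟨v, hv, rfl, h⟩
    exact ⟨v, hv, rfl, h.trans_le
      (mul_le_mul_of_nonneg_right (by exact_mod_cast hij) (norm_nonneg _))⟩)
  exact ⟨j, fun v hv hp => (hmem j v hv).1 (hj hp)⟩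

theorem norm_diagonal_mulVec_low {n : ℕ} {d : Idx n → ℝ} (hd0 : ∀ i, 0 < d i) (hd : Antitone d)
    (y : Idx n → ℂ) :
    d (midIdx n) * ‖fun i : Fin (n + 1) => y (lowIdx i)‖ ≤
      ‖diagonal (fun i => (d i : ℂ)) *ᵥ y‖ := by
  rw [mul_comm, ← le_div_iff₀ (hd0 _)]
  refine (pi_norm_le_iff_of_nonneg (div_nonneg (norm_nonneg _) (hd0 _).le)).2 fun i => ?_
  rw [le_div_iff₀ (hd0 _)]
  refine le_trans ?_ (norm_le_pi_norm _ (lowIdx i))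
  rw [mulVec_diagonal, norm_mul, Complex.norm_real, Real.norm_of_nonneg (hd0 _).le, mul_comm]
  refine mul_le_mul_of_nonneg_right (hd ?_) (norm_nonneg _)
  rw [Fin.le_def]
  exact Nat.lt_succ_iff.1 i.2

theorem norm_diagonal_mulVec_high {n : ℕ} {d : Idx n → ℝ} (hd0 : ∀ i, 0 < d i) (hd : Antitone d)
    (y : Idx n → ℂ) {k : Idx n} (hk : n < k) :
    ‖(diagonal (fun i => (d i : ℂ)) *ᵥ y) k‖ ≤ d (succIdx n) * ‖y‖ := by
  rw [mulVec_diagonal, norm_mul, Complex.norm_real, Real.norm_of_nonneg (hd0 _).le]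
  exact mul_le_mul (hd (Fin.le_def.2 hk)) (norm_le_pi_norm _ _) (norm_nonneg _) (hd0 _).le

theorem tendsto_mulVec {ι : Type*} [Fintype ι] {A : ℕ → Matrix ι ι ℂ} {A' : Matrix ι ι ℂ}
    {u : ℕ → ι → ℂ} {u' : ι → ℂ} (hA : Tendsto A atTop (𝓝 A')) (hu : Tendsto u atTop (𝓝 u')) :
    Tendsto (fun k => A k *ᵥ u k) atTop (𝓝 (A' *ᵥ u')) := by
  refine tendsto_pi_nhds.2 fun i => ?_
  simp only [mulVec, dotProduct]
  refine tendsto_finsetSum _ fun j _ => Tendsto.mul ?_ (tendsto_pi_nhds.1 hu j)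
  exact tendsto_pi_nhds.1 (tendsto_pi_nhds.1 hA i) j

/-- By contradiction: take unit vectors over `M` whose images avoid `W`, normalise them after the
diagonal factor, and extract limits. The gap kills the coordinates of index above `n`, so the
limiting image lies on `lI`. -/
theorem eventually_smul_mem_of_svd {n : ℕ} (g : ℕ → GeneralLinearGroup (Idx n) ℂ)
    (U V : ℕ → Matrix (Idx n) (Idx n) ℂ) (d : ℕ → Idx n → ℝ)
    (hV : ∀ ν, V ν ∈ unitaryGroup (Idx n) ℂ) (hd0 : ∀ ν i, 0 < d ν i)
    (hd : ∀ ν, Antitone (d ν))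
    (hsvd : ∀ ν, (g ν : Matrix (Idx n) (Idx n) ℂ) =
      U ν * diagonal (fun i => (d ν i : ℂ)) * V ν)
    {U' V' : Matrix (Idx n) (Idx n) ℂ} (hU' : U' ∈ unitaryGroup (Idx n) ℂ)
    (hUlim : Tendsto U atTop (𝓝 U')) (hVlim : Tendsto V atTop (𝓝 V'))
    (hratio : Tendsto (fun ν => d ν (succIdx n) / d ν (midIdx n)) atTop (𝓝 0))
    {lI lK : NPlane n} (hI : ∀ z : Idx n → ℂ, (∀ k : Idx n, n < k → z k = 0) →
      U' *ᵥ z ∈ lI.toSubmodule)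
    (hK : ∀ v : Idx n → ℂ, (fun i : Fin (n + 1) => (V' *ᵥ v) (lowIdx i)) = 0 →
      v ∈ lK.toSubmodule)
    {M : Set (PSpace n)} (hM : IsCompact M) (hMK : M ⊆ lK.supportᶜ)
    {W : Set (PSpace n)} (hW : W ∈ 𝓝ˢ lI.support) :
    ∃ m₀ : ℕ, ∀ ν > m₀, ∀ p ∈ M, (ProjGenLinGroup.mk (g ν) : PGL (Idx n)) • p ∈ W := by
  by_contra hcon
  push Not at hcon
  obtain ⟨ψ, hψ, hψW⟩ := extraction_of_frequently_atTop (P := fun ν => ∃ p ∈ M,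
    (ProjGenLinGroup.mk (g ν) : PGL (Idx n)) • p ∉ W) (frequently_atTop'.2 hcon)
  have hrep : ∀ k, ∃ x : Idx n → ℂ, ∃ hx : x ≠ 0, ‖x‖ = 1 ∧ Projectivization.mk ℂ x hx ∈ M ∧
      (ProjGenLinGroup.mk (g (ψ k)) : PGL (Idx n)) • Projectivization.mk ℂ x hx ∉ W := by
    intro k
    obtain ⟨p, hp, hpW⟩ := hψW k
    induction p using Projectivization.ind with | h v hv =>
    have ha : ((‖v‖⁻¹ : ℝ) : ℂ) ≠ 0 := by
      simpa using hv
    have heq : Projectivization.mk ℂ (((‖v‖⁻¹ : ℝ) : ℂ) • v) (smul_ne_zero ha hv) =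
        Projectivization.mk ℂ v hv :=
      (Projectivization.mk_eq_mk_iff' ℂ _ _ _ _).2 ⟨_, rfl⟩
    refine ⟨_, smul_ne_zero ha hv, ?_, by rwa [heq], by rwa [heq]⟩
    rw [norm_smul, Complex.norm_real, norm_inv, norm_norm,
      inv_mul_cancel₀ (norm_ne_zero_iff.2 hv)]
  choose x hx0 hx1 hxM hxW using hrep
  let y : ℕ → Idx n → ℂ := fun k => V (ψ k) *ᵥ x k
  let w : ℕ → Idx n → ℂ := fun k => diagonal (fun i => (d (ψ k) i : ℂ)) *ᵥ y k
  have hy0 : ∀ k, y k ≠ 0 := fun k => mulVec_ne_zero_of_mem (hV _) (hx0 k)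
  have hw0 : ∀ k, w k ≠ 0 := by
    intro k h
    apply hy0 k
    ext i
    have := congrFun h i
    simp only [w, mulVec_diagonal, Pi.zero_apply, mul_eq_zero] at this
    exact this.resolve_left (by exact_mod_cast (hd0 _ _).ne')
  let z : ℕ → Idx n → ℂ := fun k => ((‖w k‖⁻¹ : ℝ) : ℂ) • w k
  have hz1 : ∀ k, ‖z k‖ = 1 := by
    intro k
    rw [norm_smul, Complex.norm_real, norm_inv, norm_norm,
      inv_mul_cancel₀ (norm_ne_zero_iff.2 (hw0 k))]
  obtain ⟨⟨x', z'⟩, ⟨-, hz'⟩, θ, hθ, hlim⟩ :=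
    ((isCompact_sphere (0 : Idx n → ℂ) 1).prod
      (isCompact_sphere (0 : Idx n → ℂ) 1)).tendsto_subseq (x := fun k => (x k, z k))
      (fun k => ⟨by simpa using hx1 k, by simpa using hz1 k⟩)
  have hz'0 : z' ≠ 0 := by
    rintro rfl
    simp at hz'
  have hxlim : Tendsto (fun k => x (θ k)) atTop (𝓝 x') := (continuous_fst.tendsto _).comp hlim
  have hzlim : Tendsto (fun k => z (θ k)) atTop (𝓝 z') := (continuous_snd.tendsto _).comp hlim
  have hψθ : Tendsto (fun k => ψ (θ k)) atTop atTop := hψ.tendsto_atTop.comp hθ.tendsto_atTop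
  have hylim : Tendsto (fun k => y (θ k)) atTop (𝓝 (V' *ᵥ x')) :=
    tendsto_mulVec (hVlim.comp hψθ) hxlim
  have hcont : Continuous fun u : Idx n → ℂ => ‖fun i : Fin (n + 1) => u (lowIdx i)‖ := by
    fun_prop
  -- the limit point stays away from the repelling plane
  have hpos : 0 < ‖fun i : Fin (n + 1) => (V' *ᵥ x') (lowIdx i)‖ := by
    obtain ⟨j, hj⟩ := exists_norm_lt_of_isCompact V' hM (fun v hv hp h =>
      hMK hp ((mem_support_mk hv).2 (hK v h)))
    have hT : Tendsto (fun k => V' *ᵥ x (θ k)) atTop (𝓝 (V' *ᵥ x')) :=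
      tendsto_mulVec (A := fun _ => V') tendsto_const_nhds hxlim
    have hT2 : Tendsto (fun k => (j : ℝ) *
        ‖fun i : Fin (n + 1) => (V' *ᵥ x (θ k)) (lowIdx i)‖) atTop
        (𝓝 (j * ‖fun i : Fin (n + 1) => (V' *ᵥ x') (lowIdx i)‖)) :=
      ((hcont.tendsto (V' *ᵥ x')).comp hT).const_mul (j : ℝ)
    have h1 : (1 : ℝ) ≤ j * ‖fun i : Fin (n + 1) => (V' *ᵥ x') (lowIdx i)‖ := by
      refine ge_of_tendsto' hT2 fun k => ?_
      have := hj (x (θ k)) (hx0 _) (hxM _)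
      rw [hx1] at this
      exact this.le
    rcases (norm_nonneg fun i : Fin (n + 1) => (V' *ᵥ x') (lowIdx i)).eq_or_lt with h | h
    · rw [← h, mul_zero] at h1
      exact absurd h1 (by norm_num)
    · exact h
  have hz'k : ∀ k : Idx n, n < k → z' k = 0 := by
    intro k hk
    -- The high coordinate of `w` is at most `d_{n+1} ‖y‖`, while `‖w‖` is at least `d_n` times the
    -- norm of the low part of `y`. That low part has a nonzero limit by `hpos`.
    have h1 : ∀ m, ‖z (θ m) k‖ * ‖fun i : Fin (n + 1) => y (θ m) (lowIdx i)‖ ≤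
        d (ψ (θ m)) (succIdx n) / d (ψ (θ m)) (midIdx n) * ‖y (θ m)‖ := by
      intro m
      have ha := norm_diagonal_mulVec_low (hd0 (ψ (θ m))) (hd _) (y (θ m))
      have hb := norm_diagonal_mulVec_high (hd0 (ψ (θ m))) (hd _) (y (θ m)) hk
      have hwp : 0 < ‖w (θ m)‖ := norm_pos_iff.2 (hw0 _)
      have hzk : ‖z (θ m) k‖ = ‖w (θ m) k‖ / ‖w (θ m)‖ := by
        change ‖((‖w (θ m)‖⁻¹ : ℝ) : ℂ) * w (θ m) k‖ = _
        rw [norm_mul, Complex.norm_real, norm_inv, norm_norm, div_eq_inv_mul]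
      rw [hzk, div_mul_eq_mul_div, div_mul_eq_mul_div, div_le_div_iff₀ hwp (hd0 _ _), mul_assoc]
      refine mul_le_mul hb ?_ (mul_nonneg (norm_nonneg _) (hd0 _ _).le)
        (mul_nonneg (hd0 _ _).le (norm_nonneg _))
      rw [mul_comm]
      exact ha
    have h2 : Tendsto (fun m => ‖z (θ m) k‖ * ‖fun i : Fin (n + 1) => y (θ m) (lowIdx i)‖) atTop
        (𝓝 (‖z' k‖ * ‖fun i : Fin (n + 1) => (V' *ᵥ x') (lowIdx i)‖)) :=
      (((continuous_apply k).tendsto z').comp hzlim).norm.mul ((hcont.tendsto _).comp hylim)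
    have h3 := le_of_tendsto_of_tendsto' h2 ((hratio.comp hψθ).mul hylim.norm) h1
    rw [zero_mul] at h3
    have h4 : ‖z' k‖ ≤ 0 := by
      by_contra hneg
      exact absurd h3 (not_le.2 (mul_pos (not_le.1 hneg) hpos))
    exact norm_le_zero_iff.1 h4
  have hUz := tendsto_mulVec (hUlim.comp hψθ) hzlim
  obtain ⟨O, hO, hlO, hOW⟩ := mem_nhdsSet_iff_exists.1 hW
  have hUz0 := mulVec_ne_zero_of_mem hU' hz'0
  have hmemO := (isOpen_cone hO).mem_nhds
    (show U' *ᵥ z' ∈ {v : Idx n → ℂ | ∃ h : v ≠ 0, Projectivization.mk ℂ v h ∈ O} from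
      ⟨hUz0, hlO ((mem_support_mk hUz0).2 (hI z' hz'k))⟩)
  obtain ⟨k, hk0, hkO⟩ := (hUz.eventually_mem hmemO).exists
  apply hxW (θ k)
  rw [Projectivization.PGL.mk_smul_mk]
  refine hOW ?_
  convert hkO using 1
  refine ((Projectivization.mk_eq_mk_iff' ℂ _ _ _ _).2
    ⟨((‖w (θ k)‖⁻¹ : ℝ) : ℂ), ?_⟩).symm
  change _ • ((g (ψ (θ k)) : Matrix (Idx n) (Idx n) ℂ) *ᵥ x (θ k)) =
    U (ψ (θ k)) *ᵥ (((‖w (θ k)‖⁻¹ : ℝ) : ℂ) • w (θ k))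
  rw [hsvd, mulVec_smul]
  simp only [w, y, mulVec_mulVec, Matrix.mul_assoc]

/-! ### Inverses -/

/-- The inverse singular values increase, so the indices are reversed to make them decrease again;
the permutation is absorbed by the unitary factors. -/
theorem inv_eq_svd {n : ℕ} {g : GeneralLinearGroup (Idx n) ℂ} {U V : Matrix (Idx n) (Idx n) ℂ}
    {d : Idx n → ℝ} (hU : U ∈ unitaryGroup (Idx n) ℂ) (hV : V ∈ unitaryGroup (Idx n) ℂ)
    (hd0 : ∀ i, 0 < d i)
    (hsvd : (g : Matrix (Idx n) (Idx n) ℂ) = U * diagonal (fun i => (d i : ℂ)) * V) :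
    ((g⁻¹ : GeneralLinearGroup (Idx n) ℂ) : Matrix (Idx n) (Idx n) ℂ) =
      Vᴴ.submatrix (Equiv.refl _) Fin.revPerm *
        diagonal (fun i => (((d (Fin.revPerm i))⁻¹ : ℝ) : ℂ)) *
          Uᴴ.submatrix Fin.revPerm (Equiv.refl _) := by
  have h1 : (diagonal (fun i => (((d (Fin.revPerm i))⁻¹ : ℝ) : ℂ)) : Matrix (Idx n) (Idx n) ℂ) =
      (diagonal (fun i => (((d i)⁻¹ : ℝ) : ℂ))).submatrix Fin.revPerm Fin.revPerm := by
    rw [submatrix_diagonal_equiv]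
    rfl
  rw [h1, submatrix_mul_equiv, submatrix_mul_equiv]
  change _ = Vᴴ * diagonal (fun i => (((d i)⁻¹ : ℝ) : ℂ)) * Uᴴ
  refine Units.inv_eq_of_mul_eq_one_left ?_
  have hdd : (diagonal (fun i => (((d i)⁻¹ : ℝ) : ℂ)) : Matrix (Idx n) (Idx n) ℂ) *
      diagonal (fun i => (d i : ℂ)) = 1 := by
    rw [diagonal_mul_diagonal, ← diagonal_one]
    congr 1
    ext i
    rw [← Complex.ofReal_mul, inv_mul_cancel₀ (hd0 i).ne', Complex.ofReal_one]
  calc Vᴴ * diagonal (fun i => (((d i)⁻¹ : ℝ) : ℂ)) * Uᴴ * (g : Matrix (Idx n) (Idx n) ℂ)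
      = Vᴴ * (diagonal (fun i => (((d i)⁻¹ : ℝ) : ℂ)) * (Uᴴ * U) *
          diagonal (fun i => (d i : ℂ))) * V := by
        rw [hsvd]; simp only [Matrix.mul_assoc]
    _ = 1 := by
        rw [conjTranspose_mul_self_of_mem hU, Matrix.mul_one, hdd, Matrix.mul_one,
          conjTranspose_mul_self_of_mem hV]

end TypeL

end

/-! ### The convergence theorem -/

open Matrix TypeL in
theorem theorem3p4 (n : ℕ) (hn : 1 ≤ n) (Γ : Subgroup (TypeL.PGL (TypeL.Idx n)))
    (hΓ : TypeL.IsTypeL Γ) (σ : ℕ → TypeL.PGL (TypeL.Idx n))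
    (hσΓ : ∀ ν, σ ν ∈ Γ) (hσ : Function.Injective σ) :
    ∃ lI lK : TypeL.NPlane n, TypeL.IsLimitPlane Γ lI ∧ TypeL.IsLimitPlane Γ lK ∧
      ∃ φ : ℕ → ℕ, StrictMono φ ∧
        ∀ M : Set (TypeL.PSpace n), IsCompact M → M ⊆ (lK.support)ᶜ →
          ∀ V ∈ 𝓝ˢ lI.support, ∃ m₀ : ℕ, ∀ ν > m₀, ∀ p ∈ M, σ (φ ν) • p ∈ V := by
  obtain ⟨-, Ω, ⟨-, -, l₀, hl₀Ω⟩, hΩ⟩ := hΓ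
  choose g hg using fun ν => ProjGenLinGroup.mk_surjective (σ ν)
  choose U hU V hV d hd0 hd hsvd using fun ν => exists_svd (g ν)
  obtain ⟨⟨U', V'⟩, ⟨hU', hV'⟩, φ, hφ, hlim⟩ :=
    ((isCompact_unitaryGroup (Idx n)).prod (isCompact_unitaryGroup (Idx n))).tendsto_subseq
      (x := fun ν => (U ν, V ν)) (fun ν => ⟨hU ν, hV ν⟩)
  have hUlim : Tendsto (fun ν => U (φ ν)) atTop (𝓝 U') := (continuous_fst.tendsto _).comp hlim
  have hVlim : Tendsto (fun ν => V (φ ν)) atTop (𝓝 V') := (continuous_snd.tendsto _).comp hlim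
  have hinj : Function.Injective fun ν => σ (φ ν) := hσ.comp hφ.injective
  have hV'' : V'ᴴ.submatrix (Equiv.refl _) Fin.revPerm ∈ unitaryGroup (Idx n) ℂ :=
    submatrix_mem_unitaryGroup (Unitary.star_mem hV') _ _
  have hV''lim : Tendsto (fun ν => (V (φ ν))ᴴ.submatrix (Equiv.refl _) Fin.revPerm) atTop
      (𝓝 (V'ᴴ.submatrix (Equiv.refl _) Fin.revPerm)) := by
    have hc : Continuous fun A : Matrix (Idx n) (Idx n) ℂ =>
        Aᴴ.submatrix (Equiv.refl (Idx n)) Fin.revPerm :=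
      continuous_id.matrix_conjTranspose.matrix_submatrix _ _
    exact (hc.tendsto V').comp hVlim
  refine ⟨flagPlane U' hU', flagPlane _ hV'', ?_, ?_, φ, hφ, ?_⟩
  · exact isLimitPlane_flagPlane (fun ν => hσΓ (φ ν)) hinj (fun ν => g (φ ν)) (fun ν => hg _)
      (fun ν => U (φ ν)) (fun ν => V (φ ν)) (fun ν => d (φ ν)) (fun ν => hV _)
      (fun ν => hd0 _) (fun ν => hd _) (fun ν => hsvd _) hU' hUlim
  -- The repelling plane is the attracting plane of the inverse sequence, which also lies in `Γ`.
  · refine isLimitPlane_flagPlane (τ := fun ν => (σ (φ ν))⁻¹) (fun ν => Γ.inv_mem (hσΓ (φ ν)))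
      (inv_injective.comp hinj) (fun ν => (g (φ ν))⁻¹) (fun ν => by rw [map_inv, hg]) _
      (fun ν => (U (φ ν))ᴴ.submatrix Fin.revPerm (Equiv.refl _))
      (fun ν i => (d (φ ν) (Fin.revPerm i))⁻¹)
      (fun ν => submatrix_mem_unitaryGroup (Unitary.star_mem (hU _)) _ _)
      (fun ν i => inv_pos.2 (hd0 _ _)) (fun ν i j hij => ?_)
      (fun ν => inv_eq_svd (hU _) (hV _) (hd0 _) (hsvd _)) hV'' hV''lim
    exact inv_anti₀ (hd0 _ _) (hd _ (Fin.rev_le_rev.2 hij))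
  · intro M hM hMK W hW
    have hratio := tendsto_singularValue_ratio (hl₀Ω.trans hΩ) (fun ν => hσΓ (φ ν)) hinj
      (fun ν => g (φ ν)) (fun ν => hg _) (fun ν => U (φ ν)) (fun ν => V (φ ν))
      (fun ν => d (φ ν)) (fun ν => hV _) (fun ν => hd0 _) (fun ν => hd _) (fun ν => hsvd _)
      hU' hUlim
    have hK : ∀ v : Idx n → ℂ, (fun i : Fin (n + 1) => (V' *ᵥ v) (lowIdx i)) = 0 →
        v ∈ (flagPlane _ hV'').toSubmodule := by
      intro v hv
      -- The first `n + 1` columns of the reversed `V'ᴴ` are the last `n + 1` columns of `V'ᴴ`: an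
      -- index `k > n` reverses to one at most `n`, where `V' v` vanishes.
      have h1 : V'ᴴ.submatrix (Equiv.refl _) Fin.revPerm *ᵥ ((V' *ᵥ v) ∘ Fin.revPerm) = v := by
        rw [submatrix_mulVec_equiv]
        have : ((V' *ᵥ v) ∘ Fin.revPerm) ∘ (Fin.revPerm (n := 2 * n + 2)).symm = V' *ᵥ v := by
          ext i
          simp
        rw [this, mulVec_mulVec, conjTranspose_mul_self_of_mem hV', one_mulVec]
        rfl
      rw [← h1]
      refine mulVec_mem_flagPlane hV'' fun k hk => ?_
      have h2 := congrFun hv ⟨Fin.rev k, by rw [Fin.val_rev]; omega⟩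
      exact h2
    obtain ⟨m₀, hm₀⟩ := eventually_smul_mem_of_svd (fun ν => g (φ ν)) (fun ν => U (φ ν))
      (fun ν => V (φ ν)) (fun ν => d (φ ν)) (fun ν => hV _) (fun ν => hd0 _) (fun ν => hd _)
      (fun ν => hsvd _) hU' hUlim hVlim hratio (fun z => mulVec_mem_flagPlane hU') hK hM hMK hW
    refine ⟨m₀, fun ν hν p hp => ?_⟩
    rw [← hg]
    exact hm₀ ν hν p hp
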